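/- Let $A,E\in\mathbb{R}^{n\times n}$ with $\det E\neq 0$, let $B\in\mathbb{R}^{n\times m}$, and suppose that all eigenvalues of $E^{-1}A$ have negative real part. Let $\sigma_1,\dots,\sigma_k\in\mathbb{C}$ be distinct shifts with $\operatorname{Re}\sigma_i>0$ such that the set $\{\sigma_1,\dots,\sigma_k\}$ is closed under complex conjugation. Put $q=km$. Let $Z=[Z_1,\dots,Z_k]\in\mathbb{C}^{n\times q}$ be the ADI factor defined by $$Z_1=\sqrt{2\operatorname{Re}\sigma_1}\,(A-\sigma_1E)^{-1}B,\qquad Z_i=\sqrt{\tfrac{\operatorname{Re}\sigma_i}{\operatorname{Re}\sigma_{i-1}}}\,\bigl(I+(\sigma_i+\overline{\sigma_{i-1}})(A-\sigma_iE)^{-1}E\bigr)Z_{i-1}\quad(2\le i\le k).$$ Assume that the rational block Krylov subspace $\mathcal K=\operatorname{colsp}\{(A-\sigma_1E)^{-1}B,\dots,(A-\sigma_kE)^{-1}B\}\subseteq\mathbb{C}^n$ has dimension $q$, and let $V\in\mathbb{R}^{n\times q}$ be a real matrix whose columns form a basis of $\mathcal K$. For $W\in\mathbb{R}^{n\times q}$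 write $A_q=W^TAV$, $E_q=W^TEV$, $B_q=W^TB$, and consider the projected Lyapunov equation $$A_qP_qE_q^T+E_qP_qA_q^T+B_qB_q^T=0,\qquad P_q\in\mathbb{R}^{q\times q}.\qquad(\ast)$$ (1) Existence. If the matrix $[EV\;\,B]$ has rank $q+m$, then there is $W\in\mathbb{R}^{n\times q}$ such that $E_q$ is invertible, $(\ast)$ has exactly one solution $P_q$, and this solution satisfies $VP_qV^T=ZZ^*$. (2) Uniqueness. The matrices $E_q^{-1}A_q$ and $E_q^{-1}B_q$ are the same for all $W\in\mathbb{R}^{n\times q}$ for which $E_q$ is invertible and $(\ast)$ has a solution $P_q$ with $VP_qV^T=ZZ^*$. -/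

import Mathlib

open Matrix
open scoped ComplexConjugate

/-- The entrywise complexification of a real matrix. -/
noncomputable def toC {ι κ : Type*} (M : Matrix ι κ ℝ) : Matrix ι κ ℂ :=
  M.map (fun x : ℝ => (x : ℂ))

/-- The system `E x' = A x + B u` is asymptotically stable: all (complex) eigenvalues of `E⁻¹ A`
lie in the open left half-plane. -/
def AsymptoticallyStable {n : ℕ} (A E : Matrix (Fin n) (Fin n) ℝ) : Prop :=
  ∀ μ ∈ spectrum ℂ (toC (E⁻¹ * A)), μ.re < 0

/-- The blocks of the low-rank ADI iteration, numbered from `0`: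
`Z₀ = √(2 Re σ₀) (A - σ₀ E)⁻¹ B` and
`Zᵢ₊₁ = √(Re σᵢ₊₁ / Re σᵢ) (I + (σᵢ₊₁ + conj σᵢ) (A - σᵢ₊₁ E)⁻¹ E) Zᵢ`. -/
noncomputable def adiBlock {n m k : ℕ} (A E : Matrix (Fin n) (Fin n) ℝ)
    (B : Matrix (Fin n) (Fin m) ℝ) (σ : Fin k → ℂ) :
    (i : ℕ) → i < k → Matrix (Fin n) (Fin m) ℂ
  | 0, h =>
      ((Real.sqrt (2 * (σ ⟨0, h⟩).re) : ℝ) : ℂ) •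
        ((toC A - σ ⟨0, h⟩ • toC E)⁻¹ * toC B)
  | i + 1, h =>
      ((Real.sqrt ((σ ⟨i + 1, h⟩).re / (σ ⟨i, Nat.lt_of_succ_lt h⟩).re) : ℝ) : ℂ) •
        ((1 + (σ ⟨i + 1, h⟩ + conj (σ ⟨i, Nat.lt_of_succ_lt h⟩)) •
            ((toC A - σ ⟨i + 1, h⟩ • toC E)⁻¹ * toC E)) *
          adiBlock A E B σ i (Nat.lt_of_succ_lt h))

/-- The ADI factor `Z = [Z₁, …, Z_k]`; its `k * m` columns are indexed by
(block number, column within the block). -/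
noncomputable def adiFactor {n m k : ℕ} (A E : Matrix (Fin n) (Fin n) ℝ)
    (B : Matrix (Fin n) (Fin m) ℝ) (σ : Fin k → ℂ) : Matrix (Fin n) (Fin k × Fin m) ℂ :=
  Matrix.of fun r p => adiBlock A E B σ p.1 p.1.isLt r p.2

/-- The complex column span of a matrix. -/
def colSpan {n : ℕ} {κ : Type*} (M : Matrix (Fin n) κ ℂ) : Submodule ℂ (Fin n → ℂ) :=
  Submodule.span ℂ (Set.range M.col)

/-- The rational input block Krylov subspace
`colsp {(A - σ₁ E)⁻¹ B, …, (A - σ_k E)⁻¹ B}` of `ℂⁿ`. -/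
noncomputable def krylovSubspace {n m k : ℕ} (A E : Matrix (Fin n) (Fin n) ℝ)
    (B : Matrix (Fin n) (Fin m) ℝ) (σ : Fin k → ℂ) : Submodule ℂ (Fin n → ℂ) :=
  ⨆ i : Fin k, colSpan ((toC A - σ i • toC E)⁻¹ * toC B)

/-- `V` is a real basis (matrix) of the complex subspace `K`: its columns are real, linearly
independent, and span `K` over `ℂ`. -/
def IsRealBasis {n q : ℕ} (V : Matrix (Fin n) (Fin q) ℝ) (K : Submodule ℂ (Fin n → ℂ)) : Prop :=
  LinearIndependent ℂ (toC V).col ∧ colSpan (toC V) = K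

/-- `P` solves the Lyapunov equation `A P Eᵀ + E P Aᵀ + B Bᵀ = 0`. -/
def SolvesLyapunov {q m : ℕ} (A E : Matrix (Fin q) (Fin q) ℝ) (B : Matrix (Fin q) (Fin m) ℝ)
    (P : Matrix (Fin q) (Fin q) ℝ) : Prop :=
  A * P * Eᵀ + E * P * Aᵀ + B * Bᵀ = 0

/-- The Petrov–Galerkin projection with `V` and `W` reproduces the ADI approximation through `P`:
`E_q = Wᵀ E V` is invertible (so that the explicit form `E_q⁻¹ A_q`, `E_q⁻¹ B_q` exists),
`P` solves the projected Lyapunov equation, and `V P Vᵀ = Z Z*`. -/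
def ReproducesADI {n m k q : ℕ} (A E : Matrix (Fin n) (Fin n) ℝ) (B : Matrix (Fin n) (Fin m) ℝ)
    (σ : Fin k → ℂ) (V W : Matrix (Fin n) (Fin q) ℝ) (P : Matrix (Fin q) (Fin q) ℝ) : Prop :=
  IsUnit (Wᵀ * E * V).det ∧
  SolvesLyapunov (Wᵀ * A * V) (Wᵀ * E * V) (Wᵀ * B) P ∧
  toC (V * P * Vᵀ) = adiFactor A E B σ * (adiFactor A E B σ)ᴴ

/-!
With `F = E⁻¹ A` and `G = E⁻¹ B`, the blocks of the ADI factor satisfy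
`(F - σᵢ) Zᵢ = cᵢ (G + ∑_{j < i} cⱼ Zⱼ)` with `cᵢ = √(2 Re σᵢ)` (`isADISequence_adiBlock`). In
matrix form this is the Sylvester equation `F Z = Z T + G L` (`IsADISequence.mul_blockRow`), in which
`T` is the Kronecker product of an upper triangular matrix with diagonal `σ` and the identity,
`L = [c₁ I, …, c_k I]`, and `T + Tᴴ = Lᴴ L` (`adiWeights_conjTranspose_mul_self`).

Applying the Sylvester equation to the eigenvectors of `T` shows that the columns of `Z` span the
Krylov subspace. As its dimension is the number of columns, `Z = V Y` with `Y` invertible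
(`exists_basis_mul_eq_adiFactor`). If `E_q` is invertible, multiplying `F Z = Z T + G L` by
`E_q⁻¹ Wᵀ E` gives `a Y = Y T + b L` for `a = E_q⁻¹ A_q`, `b = E_q⁻¹ B_q`, and then
`a (Y Yᴴ) + (Y Yᴴ) aᴴ + b bᴴ = (Y Lᴴ + b) (Y Lᴴ + b)ᴴ` (`lyapunov_defect_eq`). The condition
`V P Vᵀ = Z Zᴴ` says `P = Y Yᴴ`, so the Lyapunov equation holds exactly when `b = -Y Lᴴ`, and then
`a = -Y Tᴴ Y⁻¹`. This proves uniqueness.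

For existence the matrix `-Y Lᴴ` has to be real. Indeed `Z Lᴴ + G` is the final residual factor
`∏ (F + conj σᵢ) (F - σᵢ)⁻¹ G`, which is real because the shifts are closed under conjugation
(`IsADISequence.map_conj_residual`). The rank condition then provides a real `W` with
`Wᵀ E V = I` and `Wᵀ B = -Y Lᴴ`. Since `a` is similar to `-Tᴴ`, whose spectrum lies in the open
left half-plane, the projected Lyapunov equation has at most one solution, even over `ℂ`
(`eq_of_lyapunov_of_mul_eq`). Comparing `Y Yᴴ` with its conjugate shows that it is real.
-/

/-! ### Left inverses and the Lyapunov operator -/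

namespace Matrix

theorem exists_mul_eq_one_of_linearIndependent_col {K α β : Type*} [Field K] [Fintype α]
    [DecidableEq α] [Fintype β] [DecidableEq β] {M : Matrix α β K}
    (h : LinearIndependent K M.col) : ∃ N : Matrix β α K, N * M = 1 := by
  obtain ⟨g, hg⟩ := LinearMap.exists_leftInverse_of_injective (Matrix.toLin' M)
    (LinearMap.ker_eq_bot.2 (Matrix.mulVec_injective_iff.2 h))
  refine ⟨LinearMap.toMatrix' g, ?_⟩
  rw [← LinearMap.toMatrix'_toLin' M, ← LinearMap.toMatrix'_comp, hg, LinearMap.toMatrix'_id]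

/-- The Lyapunov operator of a matrix with spectrum in the open right half-plane is injective:
`X` intertwines `T` and `-Tᴴ`, so the characteristic polynomial `p` of `T` gives
`p(-Tᴴ) X = X p(T) = 0`, where `p(-Tᴴ)` is invertible. -/
theorem eq_zero_of_conjTranspose_mul_add_mul_eq_zero {ι : Type*} [Fintype ι] [DecidableEq ι]
    {T X : Matrix ι ι ℂ} (hT : ∀ μ : ℂ, (scalar ι μ - T).det = 0 → 0 < μ.re)
    (h : Tᴴ * X + X * T = 0) : X = 0 := by
  have h' : X * T = -Tᴴ * X := by
    rw [neg_mul]; exact eq_neg_of_add_eq_zero_right h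
  have hp : ∀ p : Polynomial ℂ, X * Polynomial.aeval T p = Polynomial.aeval (-Tᴴ) p * X := by
    intro p
    induction p using Polynomial.induction_on with
    | C a => simp [Algebra.algebraMap_eq_smul_one]
    | add p q hp hq => simp [mul_add, add_mul, hp, hq]
    | monomial n a ih =>
      simp only [pow_succ, ← mul_assoc, map_mul, Polynomial.aeval_X] at ih ⊢
      rw [ih, mul_assoc, h']
      simp only [mul_assoc]
  have hu : ∀ s : Multiset ℂ, (∀ μ ∈ s, 0 < μ.re) →
      IsUnit (Polynomial.aeval (-Tᴴ) (s.map fun μ => Polynomial.X - Polynomial.C μ).prod) := by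
    intro s
    induction s using Multiset.induction_on with
    | empty => simp
    | cons μ s ih =>
      intro hs
      rw [Multiset.map_cons, Multiset.prod_cons, map_mul]
      refine IsUnit.mul ?_ (ih fun ν hν => hs ν (Multiset.mem_cons_of_mem hν))
      have hμ := hs μ (Multiset.mem_cons_self _ _)
      have h1 : IsUnit (scalar ι (-conj μ) - T) := by
        rw [isUnit_iff_isUnit_det, isUnit_iff_ne_zero]
        intro h0
        have := hT _ h0
        simp at this
        linarith
      have h2 : Polynomial.aeval (-Tᴴ) (Polynomial.X - Polynomial.C μ)
          = (scalar ι (-conj μ) - T)ᴴ := by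
        ext i j
        simp [Algebra.algebraMap_eq_smul_one, Matrix.one_apply, Matrix.diagonal_apply, eq_comm]
        split_ifs <;> simp
        ring
      rw [h2]
      exact (isUnit_conjTranspose _).2 h1
  have hc := hp T.charpoly
  rw [aeval_self_charpoly, mul_zero,
    (IsAlgClosed.splits T.charpoly).eq_prod_roots_of_monic (charpoly_monic T)] at hc
  have hU := hu T.charpoly.roots (fun μ hμ => hT μ (by
    rw [← eval_charpoly]; exact (Polynomial.mem_roots'.1 hμ).2))
  exact hU.mul_right_eq_zero.1 hc.symm

end Matrix

/-! ### Complexification of real matrices -/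

section toC
variable {ι κ l : Type*}

theorem toC_mul [Fintype κ] (M : Matrix ι κ ℝ) (N : Matrix κ l ℝ) :
    toC (M * N) = toC M * toC N := by
  ext; simp [toC, Matrix.mul_apply]

theorem toC_add (M N : Matrix ι κ ℝ) : toC (M + N) = toC M + toC N := by
  ext; simp [toC]

theorem toC_zero : toC (0 : Matrix ι κ ℝ) = 0 := by
  ext; simp [toC]

theorem toC_one [DecidableEq ι] : toC (1 : Matrix ι ι ℝ) = 1 := by
  ext i j; simp [toC, Matrix.one_apply]; split_ifs <;> simp

theorem toC_injective : Function.Injective (toC : Matrix ι κ ℝ → Matrix ι κ ℂ) :=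
  Matrix.map_injective Complex.ofReal_injective

theorem toC_transpose (M : Matrix ι κ ℝ) : toC Mᵀ = (toC M)ᴴ := by
  ext; simp [toC]

theorem toC_map_conj (M : Matrix ι κ ℝ) : (toC M).map conj = toC M := by
  ext; simp [toC]

theorem exists_toC_eq {M : Matrix ι κ ℂ} (h : M.map conj = M) : ∃ N, toC N = M :=
  ⟨M.map Complex.re, by
    ext i j
    exact Complex.conj_eq_iff_re.1 (congrFun (congrFun h i) j)⟩

end toC

/-! ### The ADI recursion as a Sylvester equation -/

section ADI
open scoped Kronecker

variable {ν μ : Type*} {k : ℕ}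

/-- The upper triangular `k × k` matrix with the shifts on the diagonal and `c j * c i` in
position `(j, i)` for `j < i`. With `c i ^ 2 = 2 Re σᵢ` its Hermitian part is `c cᵀ / 2`. -/
noncomputable def adiCoupling (σ : Fin k → ℂ) (c : Fin k → ℝ) : Matrix (Fin k) (Fin k) ℂ :=
  Matrix.of fun j i => if j = i then σ i else if j < i then (c j : ℂ) * c i else 0

/-- The matrix `[c₁ I, …, c_k I]` with `k` blocks of size `μ`. -/
noncomputable def adiWeights (μ : Type*) [DecidableEq μ] (c : Fin k → ℝ) :
    Matrix μ (Fin k × μ) ℂ :=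
  Matrix.of fun b p => if b = p.2 then (c p.1 : ℂ) else 0

/-- The matrix `[Z₁, …, Z_k]` whose columns are indexed by (block number, column). -/
def blockRow (Z : Fin k → Matrix ν μ ℂ) : Matrix ν (Fin k × μ) ℂ :=
  Matrix.of fun r p => Z p.1 r p.2

/-- The residual-based form of the ADI recursion for the pair `(F, G)`: the residual factor before
step `i` is `G + ∑_{j < i} c_j Z_j`, and `(F - σᵢ) Zᵢ` is `cᵢ` times it. -/
def IsADISequence [Fintype ν] [DecidableEq ν] (F : Matrix ν ν ℂ) (G : Matrix ν μ ℂ)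
    (σ : Fin k → ℂ) (c : Fin k → ℝ) (Z : Fin k → Matrix ν μ ℂ) : Prop :=
  ∀ i, (F - σ i • 1) * Z i = (c i : ℂ) • (G + ∑ j, if j < i then (c j : ℂ) • Z j else 0)

theorem det_scalar_sub_adiCoupling (σ : Fin k → ℂ) (c : Fin k → ℝ) (z : ℂ) :
    (scalar (Fin k) z - adiCoupling σ c).det = ∏ i, (z - σ i) := by
  rw [det_of_isUpperTriangular]
  · simp [adiCoupling]
  · intro i j hij
    have h : j < i := hij
    simp [adiCoupling, h.ne', h.not_gt]

theorem adiCoupling_add_conjTranspose {σ : Fin k → ℂ} {c : Fin k → ℝ}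
    (hc : ∀ i, c i ^ 2 = 2 * (σ i).re) :
    adiCoupling σ c + (adiCoupling σ c)ᴴ = vecMulVec (fun i => (c i : ℂ)) (fun i => (c i : ℂ)) := by
  ext i j
  have h2 : (σ i) + conj (σ i) = c i * c i := by
    rw [Complex.add_conj, ← hc]; push_cast; ring
  rcases lt_trichotomy i j with h | h | h
  · simp [adiCoupling, vecMulVec_apply, h, h.ne, h.ne', h.not_gt]
  · subst h
    simpa [adiCoupling, vecMulVec_apply] using h2
  · simp [adiCoupling, vecMulVec_apply, h, h.ne, h.ne', h.not_gt, mul_comm]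

open scoped ComplexOrder in
/-- The Hermitian part of the coupling matrix only sees a vector through `∑ cᵢ yᵢ`; were this zero
for an eigenvector, the eigenvalue would be purely imaginary. -/
theorem exists_eigenvector_adiCoupling {σ : Fin k → ℂ} {c : Fin k → ℝ}
    (hpos : ∀ i, 0 < (σ i).re) (hc : ∀ i, c i ^ 2 = 2 * (σ i).re) (i : Fin k) :
    ∃ y : Fin k → ℂ, adiCoupling σ c *ᵥ y = σ i • y ∧ ∑ j, (c j : ℂ) * y j ≠ 0 := by
  obtain ⟨y, hy0, hy⟩ := (exists_mulVec_eq_zero_iff (M := scalar (Fin k) (σ i) -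
    adiCoupling σ c)).2 (by
      rw [det_scalar_sub_adiCoupling]
      exact Finset.prod_eq_zero (Finset.mem_univ i) (sub_self _))
  have hy' : adiCoupling σ c *ᵥ y = σ i • y := by
    rw [sub_mulVec, sub_eq_zero] at hy
    rw [← hy]; ext j; simp [scalar_apply, mulVec_diagonal]
  refine ⟨y, hy', fun h0 => hy0 ?_⟩
  have h1 : (adiCoupling σ c + (adiCoupling σ c)ᴴ) *ᵥ y = 0 := by
    rw [adiCoupling_add_conjTranspose hc]
    ext j
    simp only [mulVec, dotProduct, vecMulVec_apply, mul_assoc, ← Finset.mul_sum, h0, mul_zero,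
      Pi.zero_apply]
  have h2 : star y ⬝ᵥ ((adiCoupling σ c)ᴴ *ᵥ y) = conj (σ i) * (star y ⬝ᵥ y) := by
    rw [dotProduct_mulVec, ← star_mulVec, hy', star_smul, smul_dotProduct]; rfl
  have h3 : (σ i + conj (σ i)) * (star y ⬝ᵥ y) = 0 := by
    have := congrArg (fun v => star y ⬝ᵥ v) h1
    simpa [add_mulVec, hy', h2, dotProduct_add, dotProduct_smul, add_mul] using this
  have h4 : σ i + conj (σ i) ≠ 0 := by
    rw [Complex.add_conj]
    exact_mod_cast (mul_pos two_pos (hpos i)).ne'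
  exact dotProduct_star_self_eq_zero.1
    ((mul_eq_zero.1 h3).resolve_left h4)

variable [Fintype ν] [DecidableEq ν]

theorem re_pos_of_det_kronecker_eq_zero [Fintype μ] [DecidableEq μ]
    {σ : Fin k → ℂ} {c : Fin k → ℝ}
    (hpos : ∀ i, 0 < (σ i).re) (z : ℂ)
    (hz : (scalar (Fin k × μ) z - adiCoupling σ c ⊗ₖ (1 : Matrix μ μ ℂ)).det = 0) :
    0 < z.re := by
  have h : scalar (Fin k × μ) z - adiCoupling σ c ⊗ₖ (1 : Matrix μ μ ℂ)
      = (scalar (Fin k) z - adiCoupling σ c) ⊗ₖ (1 : Matrix μ μ ℂ) := by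
    ext ⟨i, a⟩ ⟨j, b⟩
    simp [scalar_apply, diagonal_apply, one_apply]
    by_cases hi : i = j <;> by_cases ha : a = b <;> simp [hi, ha]
  rw [h, det_kronecker, det_one, one_pow, mul_one] at hz
  have hz := eq_zero_of_pow_eq_zero hz
  rw [det_scalar_sub_adiCoupling, Finset.prod_eq_zero_iff] at hz
  obtain ⟨i, -, hi⟩ := hz
  rw [sub_eq_zero.1 hi]
  exact hpos i

theorem adiWeights_conjTranspose_mul_self [Fintype μ] [DecidableEq μ]
    {σ : Fin k → ℂ} {c : Fin k → ℝ}
    (hc : ∀ i, c i ^ 2 = 2 * (σ i).re) :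
    (adiWeights μ c)ᴴ * adiWeights μ c
      = adiCoupling σ c ⊗ₖ (1 : Matrix μ μ ℂ)
        + (adiCoupling σ c ⊗ₖ (1 : Matrix μ μ ℂ))ᴴ := by
  have h : adiCoupling σ c ⊗ₖ (1 : Matrix μ μ ℂ)
        + (adiCoupling σ c ⊗ₖ (1 : Matrix μ μ ℂ))ᴴ
      = (adiCoupling σ c + (adiCoupling σ c)ᴴ) ⊗ₖ (1 : Matrix μ μ ℂ) := by
    ext ⟨i, a⟩ ⟨j, b⟩
    by_cases hab : a = b <;> simp [one_apply, hab, eq_comm (a := b)]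
  rw [h, adiCoupling_add_conjTranspose hc]
  ext ⟨i, a⟩ ⟨j, b⟩
  simp [adiWeights, mul_apply, vecMulVec_apply, one_apply, apply_ite conj, eq_comm (a := b)]

/-- The Sylvester equation satisfied by the ADI factor. -/
theorem IsADISequence.mul_blockRow [Fintype μ] [DecidableEq μ]
    {F : Matrix ν ν ℂ} {G : Matrix ν μ ℂ} {σ : Fin k → ℂ} {c : Fin k → ℝ}
    {Z : Fin k → Matrix ν μ ℂ} (h : IsADISequence F G σ c Z) :
    F * blockRow Z = blockRow Z * adiCoupling σ c ⊗ₖ (1 : Matrix μ μ ℂ)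
      + G * adiWeights μ c := by
  ext r ⟨i, a⟩
  have hi := congrFun (congrFun (h i) r) a
  have h1 : (F * blockRow Z) r (i, a) = (F * Z i) r a := by simp [mul_apply, blockRow]
  have h2 : (G * adiWeights μ c) r (i, a) = c i * G r a := by
    simp [mul_apply, adiWeights, mul_comm]
  have h3 : (blockRow Z * adiCoupling σ c ⊗ₖ (1 : Matrix μ μ ℂ)) r (i, a)
      = ∑ j, Z j r a * adiCoupling σ c j i := by
    simp [mul_apply, blockRow, Fintype.sum_prod_type, one_apply]
  have h4 : ∑ j, Z j r a * adiCoupling σ c j i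
      = σ i * Z i r a + c i * ∑ j, if j < i then (c j : ℂ) * Z j r a else 0 := by
    have : ∀ j, Z j r a * adiCoupling σ c j i = (if j = i then σ i * Z i r a else 0)
        + c i * (if j < i then (c j : ℂ) * Z j r a else 0) := by
      intro j
      rcases lt_trichotomy j i with h | h | h
      · simp [adiCoupling, h, h.ne]; ring
      · subst h; simp [adiCoupling, mul_comm]
      · simp [adiCoupling, h.ne', h.not_gt]
    simp [this, Finset.sum_add_distrib, Finset.mul_sum]
  rw [Matrix.add_apply, h1, h2, h3, h4]
  simp only [Matrix.sub_mul, smul_mul, Matrix.one_mul, Matrix.sub_apply, Matrix.smul_apply,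
    smul_eq_mul, Matrix.add_apply, Matrix.sum_apply, apply_ite (fun M : Matrix ν μ ℂ => M r a),
    Matrix.zero_apply] at hi
  linear_combination hi

/-- Every block `(F - σᵢ)⁻¹ G` spanning the Krylov subspace is a combination of the columns of
the ADI factor: apply the Sylvester equation to an eigenvector of the coupling matrix. -/
theorem IsADISequence.exists_blockRow_mul_eq [Fintype μ] [DecidableEq μ]
    {F : Matrix ν ν ℂ} {G : Matrix ν μ ℂ} {σ : Fin k → ℂ} {c : Fin k → ℝ}
    {Z : Fin k → Matrix ν μ ℂ} (h : IsADISequence F G σ c Z)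
    (hpos : ∀ i, 0 < (σ i).re) (hc : ∀ i, c i ^ 2 = 2 * (σ i).re)
    (i : Fin k) (hu : IsUnit (F - σ i • 1)) :
    ∃ N : Matrix (Fin k × μ) μ ℂ, blockRow Z * N = (F - σ i • 1)⁻¹ * G := by
  obtain ⟨y, hy, hl⟩ := exists_eigenvector_adiCoupling hpos hc i
  set l := ∑ j, (c j : ℂ) * y j
  let N : Matrix (Fin k × μ) μ ℂ := Matrix.of fun p a => if p.2 = a then y p.1 else 0
  have h1 : adiCoupling σ c ⊗ₖ (1 : Matrix μ μ ℂ) * N = σ i • N := by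
    ext ⟨j, b⟩ a
    have := congrFun hy j
    simp only [mulVec, dotProduct, Pi.smul_apply, smul_eq_mul] at this
    by_cases hba : b = a <;>
      simp [mul_apply, N, Fintype.sum_prod_type, one_apply, hba, this]
  have h2 : adiWeights μ c * N = l • 1 := by
    ext b a
    by_cases hba : b = a <;>
      simp [mul_apply, N, Fintype.sum_prod_type, one_apply, adiWeights, hba, l]
  have h3 : (F - σ i • 1) * (blockRow Z * N) = l • G := by
    rw [Matrix.sub_mul, ← Matrix.mul_assoc, h.mul_blockRow, Matrix.add_mul, Matrix.mul_assoc,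
      Matrix.mul_assoc, h1, h2]
    simp
  refine ⟨l⁻¹ • N, ?_⟩
  have hd := (isUnit_iff_isUnit_det _).1 hu
  have h4 := congrArg (fun M => (F - σ i • 1)⁻¹ * M) h3
  simp only [nonsing_inv_mul_cancel_left _ _ hd] at h4
  rw [Matrix.mul_smul, h4, Matrix.mul_smul, smul_smul, inv_mul_cancel₀ hl, one_smul]

/-- The final residual factor is `∏ (F + conj σᵢ) (F - σᵢ)⁻¹ G`, here with cleared denominators.
As polynomials in `F` the factors commute, so the order of the shifts is irrelevant. -/
theorem IsADISequence.aeval_mul_residual {F : Matrix ν ν ℂ} {G : Matrix ν μ ℂ} {σ : Fin k → ℂ}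
    {c : Fin k → ℝ} {Z : Fin k → Matrix ν μ ℂ} (h : IsADISequence F G σ c Z)
    (hc : ∀ i, c i ^ 2 = 2 * (σ i).re) :
    Polynomial.aeval F (∏ i, (Polynomial.X - Polynomial.C (σ i))) * (G + ∑ j, (c j : ℂ) • Z j)
      = Polynomial.aeval F (∏ i, (Polynomial.X + Polynomial.C (conj (σ i)))) * G := by
  induction k with
  | zero => simp
  | succ k ih =>
    have h' : IsADISequence F G (σ ∘ Fin.castSucc) (c ∘ Fin.castSucc) (Z ∘ Fin.castSucc) := by
      intro i
      have := h i.castSucc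
      simpa [Fin.sum_univ_castSucc, (Fin.castSucc_lt_last i).not_gt] using this
    have ih := ih h' (fun i => hc _)
    have hl := h (Fin.last k)
    simp only [Fin.sum_univ_castSucc, Fin.castSucc_lt_last, if_true, lt_irrefl, if_false,
      add_zero] at hl
    simp only [Function.comp_def] at ih
    rw [Fin.prod_univ_castSucc, Fin.prod_univ_castSucc, Fin.sum_univ_castSucc, map_mul]
    set S := ∑ j : Fin k, (c j.castSucc : ℂ) • Z j.castSucc
    have e1 : Polynomial.aeval F (Polynomial.X - Polynomial.C (σ (Fin.last k)))
        = F - σ (Fin.last k) • 1 := by simp [Algebra.algebraMap_eq_smul_one]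
    have e2 : Polynomial.aeval F (Polynomial.X + Polynomial.C (conj (σ (Fin.last k))))
        = F + conj (σ (Fin.last k)) • 1 := by simp [Algebra.algebraMap_eq_smul_one]
    have hs : (c (Fin.last k) : ℂ) * c (Fin.last k) = σ (Fin.last k) + conj (σ (Fin.last k)) := by
      rw [Complex.add_conj, ← hc]; push_cast; ring
    have key : (F - σ (Fin.last k) • 1) * (G + (S + (c (Fin.last k) : ℂ) • Z (Fin.last k)))
        = (F + conj (σ (Fin.last k)) • 1) * (G + S) := by
      rw [← add_assoc, Matrix.mul_add, Matrix.mul_smul, hl, smul_smul, hs]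
      simp only [Matrix.sub_mul, Matrix.add_mul, add_smul, smul_mul, Matrix.one_mul]
      abel
    rw [Matrix.mul_assoc, e1, key, ← e2, ← Matrix.mul_assoc, ← map_mul, mul_comm, map_mul,
      Matrix.mul_assoc, ih, ← Matrix.mul_assoc, ← map_mul, mul_comm]

/-- For real data and a set of shifts closed under conjugation the final residual factor is real:
it solves a linear system with real coefficients. -/
theorem IsADISequence.map_conj_residual {F : Matrix ν ν ℂ} {G : Matrix ν μ ℂ} {σ : Fin k → ℂ}
    {c : Fin k → ℝ} {Z : Fin k → Matrix ν μ ℂ} (h : IsADISequence F G σ c Z)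
    (hc : ∀ i, c i ^ 2 = 2 * (σ i).re) (hu : ∀ i, IsUnit (F - σ i • 1))
    (hinj : Function.Injective σ) (hconj : ∀ i, ∃ j, σ j = conj (σ i))
    (hF : F.map conj = F) (hG : G.map conj = G) :
    (G + ∑ j, (c j : ℂ) • Z j).map conj = G + ∑ j, (c j : ℂ) • Z j := by
  have hmap : ∀ p : Polynomial ℂ,
      (Polynomial.aeval F p).map conj = Polynomial.aeval F (p.map (starRingEnd ℂ)) := by
    intro p
    have := Polynomial.map_aeval_eq_aeval_map (S := Matrix ν ν ℂ) (U := Matrix ν ν ℂ)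
      (φ := starRingEnd ℂ) (ψ := (starRingEnd ℂ).mapMatrix) (by
        ext a i j
        simp [algebraMap_matrix_apply, apply_ite (starRingEnd ℂ)]) p F
    simpa [hF] using this
  -- conjugation permutes the shifts, hence fixes both products
  choose τ hτ using hconj
  have hτb : Function.Bijective τ := by
    refine Finite.injective_iff_bijective.1 fun i j hij => hinj ?_
    have := hτ i
    rw [hij, hτ j] at this
    exact (star_injective this).symm
  have hq : (∏ i, (Polynomial.X - Polynomial.C (σ i))).map (starRingEnd ℂ)
      = ∏ i, (Polynomial.X - Polynomial.C (σ i)) := by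
    rw [Polynomial.map_prod]
    refine Fintype.prod_bijective τ hτb _ _ fun i => ?_
    simp [hτ]
  have hp : (∏ i, (Polynomial.X + Polynomial.C (conj (σ i)))).map (starRingEnd ℂ)
      = ∏ i, (Polynomial.X + Polynomial.C (conj (σ i))) := by
    rw [Polynomial.map_prod]
    refine Fintype.prod_bijective τ hτb _ _ fun i => ?_
    simp [hτ]
  have hr := h.aeval_mul_residual hc
  have hr' := congrArg (fun M : Matrix ν μ ℂ => M.map (starRingEnd ℂ)) hr
  simp only [Matrix.map_mul, hmap, hq, hp, hG] at hr'
  rw [← hr] at hr'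
  have hU : IsUnit (Polynomial.aeval F (∏ i, (Polynomial.X - Polynomial.C (σ i)))) := by
    refine Finset.prod_induction _ (fun p => IsUnit (Polynomial.aeval F p))
      (fun p q hp hq => by rw [map_mul]; exact hp.mul hq) (by simp) fun i _ => ?_
    simpa [Algebra.algebraMap_eq_smul_one] using hu i
  have hd := (isUnit_iff_isUnit_det _).1 hU
  have := congrArg (fun M => (Polynomial.aeval F (∏ i, (Polynomial.X - Polynomial.C (σ i))))⁻¹ * M)
    hr'
  simpa only [nonsing_inv_mul_cancel_left _ _ hd] using this

end ADI

/-! ### Lyapunov equations in the coordinates of the ADI factor -/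

section Projection
variable {α β ι : Type*} [Fintype α] [Fintype β] [Fintype ι]

/-- The defect of the projected Lyapunov equation at `Y Yᴴ` is `(Y Lᴴ + b) (Y Lᴴ + b)ᴴ`. -/
theorem lyapunov_defect_eq {a : Matrix α α ℂ} {b : Matrix α β ℂ} {Y : Matrix α ι ℂ}
    {T : Matrix ι ι ℂ} {L : Matrix β ι ℂ} (hL : Lᴴ * L = T + Tᴴ) (ha : a * Y = Y * T + b * L) :
    a * (Y * Yᴴ) + Y * Yᴴ * aᴴ + b * bᴴ = (Y * Lᴴ + b) * (Y * Lᴴ + b)ᴴ := by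
  have ha' : Yᴴ * aᴴ = Tᴴ * Yᴴ + Lᴴ * bᴴ := by
    rw [← conjTranspose_mul, ha]; simp
  have h1 : Y * Lᴴ * (L * Yᴴ) = Y * T * Yᴴ + Y * Tᴴ * Yᴴ := by
    rw [Matrix.mul_assoc, ← Matrix.mul_assoc Lᴴ, hL, Matrix.add_mul, Matrix.mul_add,
      Matrix.mul_assoc, Matrix.mul_assoc]
  rw [← Matrix.mul_assoc a, ha, Matrix.mul_assoc Y, ha', conjTranspose_add, conjTranspose_mul,
    conjTranspose_conjTranspose, Matrix.mul_add (Y * Lᴴ + b), Matrix.add_mul (Y * Lᴴ), h1]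
  simp only [Matrix.add_mul, Matrix.mul_add, Matrix.mul_assoc]
  abel

theorem eq_neg_of_lyapunov {a : Matrix α α ℂ} {b : Matrix α β ℂ} {Y : Matrix α ι ℂ}
    {T : Matrix ι ι ℂ} {L : Matrix β ι ℂ} (hL : Lᴴ * L = T + Tᴴ) (ha : a * Y = Y * T + b * L)
    (h : a * (Y * Yᴴ) + Y * Yᴴ * aᴴ + b * bᴴ = 0) : b = -(Y * Lᴴ) := by
  open scoped ComplexOrder in
  rw [lyapunov_defect_eq hL ha, self_mul_conjTranspose_eq_zero] at h
  exact eq_neg_of_add_eq_zero_right h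

theorem mul_eq_neg_mul_conjTranspose {a : Matrix α α ℂ} {b : Matrix α β ℂ} {Y : Matrix α ι ℂ}
    {T : Matrix ι ι ℂ} {L : Matrix β ι ℂ} (hL : Lᴴ * L = T + Tᴴ) (ha : a * Y = Y * T + b * L)
    (hb : b = -(Y * Lᴴ)) : a * Y = -(Y * Tᴴ) := by
  rw [ha, hb, Matrix.neg_mul, Matrix.mul_assoc, hL, Matrix.mul_add]
  abel

/-- If `a` is similar to `-Tᴴ` and the spectrum of `T` lies in the open right half-plane, then the
Lyapunov equation with coefficient `a` has at most one solution. -/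
theorem eq_of_lyapunov_of_mul_eq [DecidableEq α] [DecidableEq ι]
    {a : Matrix α α ℂ} {Q D D' : Matrix α α ℂ} {Y : Matrix α ι ℂ}
    {Y' : Matrix ι α ℂ} {T : Matrix ι ι ℂ} (hT : ∀ z : ℂ, (scalar ι z - T).det = 0 → 0 < z.re)
    (h1 : Y * Y' = 1) (h2 : Y' * Y = 1) (ha : a * Y = -(Y * Tᴴ))
    (hD : a * D + D * aᴴ + Q = 0) (hD' : a * D' + D' * aᴴ + Q = 0) : D = D' := by
  have e1 : Y' * a = -(Tᴴ * Y') := by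
    calc Y' * a = Y' * (a * Y) * Y' := by
          rw [Matrix.mul_assoc, Matrix.mul_assoc a, h1, Matrix.mul_one]
      _ = -(Tᴴ * Y') := by
          rw [ha, Matrix.mul_neg, Matrix.neg_mul, ← Matrix.mul_assoc Y', h2, Matrix.one_mul]
  have e2 : aᴴ * Y'ᴴ = -(Y'ᴴ * T) := by
    rw [← conjTranspose_mul, e1]; simp
  have h0 : a * (D - D') + (D - D') * aᴴ = 0 := by
    rw [Matrix.mul_sub, Matrix.sub_mul, ← sub_eq_zero.2 (hD.trans hD'.symm)]
    abel
  set X := D - D' with hX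
  have h3 : Y' * X * Y'ᴴ = 0 := by
    refine eq_zero_of_conjTranspose_mul_add_mul_eq_zero hT ?_
    have : Y' * (a * X + X * aᴴ) * Y'ᴴ = 0 := by rw [h0]; simp
    rw [Matrix.mul_add, Matrix.add_mul, ← Matrix.mul_assoc, e1, Matrix.mul_assoc Y' _ Y'ᴴ,
      Matrix.mul_assoc X, e2] at this
    have := congrArg Neg.neg this
    simpa [Matrix.mul_assoc, add_comm] using this
  have h4 : X = Y * (Y' * X * Y'ᴴ) * Yᴴ := by
    rw [Matrix.mul_assoc, Matrix.mul_assoc, ← conjTranspose_mul, h1, conjTranspose_one,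
      Matrix.mul_one, ← Matrix.mul_assoc, h1, Matrix.one_mul]
  rw [h3] at h4
  exact sub_eq_zero.1 (by rw [← hX, h4]; simp)

end Projection

/-! ### The ADI factor and the Krylov subspace -/

section Setup
variable {n m k : ℕ} {A E : Matrix (Fin n) (Fin n) ℝ} {B : Matrix (Fin n) (Fin m) ℝ}
  {σ : Fin k → ℂ}

theorem isUnit_sub_smul_one_of_asymptoticallyStable (h : AsymptoticallyStable A E) {z : ℂ}
    (hz : 0 < z.re) : IsUnit (toC (E⁻¹ * A) - z • 1) := by
  by_contra hn
  refine (h z ?_).not_gt hz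
  rw [spectrum.mem_iff]
  rwa [← IsUnit.neg_iff, neg_sub, Algebra.algebraMap_eq_smul_one]

theorem toC_sub_smul_eq (hE : IsUnit E.det) (z : ℂ) :
    toC A - z • toC E = toC E * (toC (E⁻¹ * A) - z • 1) := by
  rw [Matrix.mul_sub, ← toC_mul, mul_nonsing_inv_cancel_left _ _ hE]
  simp

theorem toC_mul_toC_inv (hE : IsUnit E.det) : toC E⁻¹ * toC E = 1 := by
  rw [← toC_mul, nonsing_inv_mul _ hE, toC_one]

theorem inv_toC (hE : IsUnit E.det) : (toC E)⁻¹ = toC E⁻¹ :=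
  inv_eq_left_inv (toC_mul_toC_inv hE)

theorem inv_toC_sub_smul_mul (hE : IsUnit E.det) (z : ℂ) {κ : Type*} (M : Matrix (Fin n) κ ℂ) :
    (toC A - z • toC E)⁻¹ * M = (toC (E⁻¹ * A) - z • 1)⁻¹ * (toC E⁻¹ * M) := by
  rw [toC_sub_smul_eq hE, Matrix.mul_inv_rev, inv_toC hE, Matrix.mul_assoc]

/-- The ADI recursion in residual form. The step from `i` to `i + 1` uses that the new residual
factor is `(F + conj σᵢ) Zᵢ / cᵢ`. -/
theorem isADISequence_adiBlock (hE : IsUnit E.det) (hpos : ∀ i, 0 < (σ i).re)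
    (hu : ∀ i, IsUnit (toC (E⁻¹ * A) - σ i • 1)) :
    IsADISequence (toC (E⁻¹ * A)) (toC (E⁻¹ * B)) σ (fun i => Real.sqrt (2 * (σ i).re))
      (fun i => adiBlock A E B σ i i.isLt) := by
  have key : ∀ (i : ℕ) (hi : i < k), (toC (E⁻¹ * A) - σ ⟨i, hi⟩ • 1) * adiBlock A E B σ i hi
      = ((Real.sqrt (2 * (σ ⟨i, hi⟩).re) : ℝ) : ℂ) • (toC (E⁻¹ * B) + ∑ j : Fin k,
        if j < ⟨i, hi⟩ then ((Real.sqrt (2 * (σ j).re) : ℝ) : ℂ) • adiBlock A E B σ j j.isLt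
        else 0) := by
    intro i
    induction i with
    | zero =>
      intro hi
      have hd := (isUnit_iff_isUnit_det _).1 (hu ⟨0, hi⟩)
      have h0 : ∀ j : Fin k, ¬ j < ⟨0, hi⟩ := fun j hj => Nat.not_lt_zero _ hj
      simp only [h0, if_false, Finset.sum_const_zero, add_zero]
      rw [adiBlock, inv_toC_sub_smul_mul hE, Matrix.mul_smul, mul_nonsing_inv_cancel_left _ _ hd,
        toC_mul]
    | succ i ih =>
      intro hi
      have hi' : i < k := Nat.lt_of_succ_lt hi
      have ih := ih hi'
      have hd := (isUnit_iff_isUnit_det _).1 (hu ⟨i + 1, hi⟩)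
      set s := σ ⟨i, hi'⟩ with hs
      set s' := σ ⟨i + 1, hi⟩ with hs'
      set F := toC (E⁻¹ * A)
      set Z := adiBlock A E B σ i hi' with hZ
      have hsum : (∑ j : Fin k, if j < ⟨i + 1, hi⟩ then
            ((Real.sqrt (2 * (σ j).re) : ℝ) : ℂ) • adiBlock A E B σ j j.isLt else 0)
          = (∑ j : Fin k, if j < ⟨i, hi'⟩ then
            ((Real.sqrt (2 * (σ j).re) : ℝ) : ℂ) • adiBlock A E B σ j j.isLt else 0)
            + ((Real.sqrt (2 * s.re) : ℝ) : ℂ) • Z := by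
        have hsplit : ∀ j : Fin k, (if j < ⟨i + 1, hi⟩ then
              ((Real.sqrt (2 * (σ j).re) : ℝ) : ℂ) • adiBlock A E B σ j j.isLt else 0)
            = (if j < ⟨i, hi'⟩ then
              ((Real.sqrt (2 * (σ j).re) : ℝ) : ℂ) • adiBlock A E B σ j j.isLt else 0)
              + if j = ⟨i, hi'⟩ then ((Real.sqrt (2 * s.re) : ℝ) : ℂ) • Z else 0 := by
          rintro ⟨j, hj⟩
          simp only [Fin.mk_lt_mk, Fin.mk.injEq]
          rcases lt_trichotomy j i with h | h | h
          · simp [h, h.ne, h.trans (Nat.lt_succ_self i)]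
          · subst h; simp [hs, hZ]
          · simp [h.ne', h.not_gt, Nat.not_lt.2 (Nat.succ_le_of_lt h)]
        simp only [hsplit, Finset.sum_add_distrib, Finset.sum_ite_eq', Finset.mem_univ, if_true]
      have hss : ((Real.sqrt (2 * s.re) : ℝ) : ℂ) * ((Real.sqrt (2 * s.re) : ℝ) : ℂ)
          = s + conj s := by
        rw [Complex.add_conj, ← Complex.ofReal_mul,
          Real.mul_self_sqrt (mul_pos two_pos (hpos _)).le]
      have hquot : Real.sqrt (s'.re / s.re) * Real.sqrt (2 * s.re) = Real.sqrt (2 * s'.re) := by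
        rw [← Real.sqrt_mul (div_pos (hpos _) (hpos _)).le]
        rw [mul_left_comm, div_mul_cancel₀ _ (hpos _).ne']
      have hstep : (F + conj s • 1) * Z = ((Real.sqrt (2 * s.re) : ℝ) : ℂ) • (toC (E⁻¹ * B) +
          ∑ j : Fin k, if j < ⟨i + 1, hi⟩ then
            ((Real.sqrt (2 * (σ j).re) : ℝ) : ℂ) • adiBlock A E B σ j j.isLt else 0) := by
        rw [hsum, ← add_assoc, smul_add, ← ih, smul_smul, hss]
        simp only [Matrix.sub_mul, Matrix.add_mul, smul_mul, Matrix.one_mul, add_smul]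
        abel
      have hmul : (F - s' • 1) * ((1 + (s' + conj s) •
          ((toC A - s' • toC E)⁻¹ * toC E)) * Z) = (F + conj s • 1) * Z := by
        rw [inv_toC_sub_smul_mul hE, toC_mul_toC_inv hE, Matrix.mul_one, ← Matrix.mul_assoc,
          Matrix.mul_add, Matrix.mul_smul, mul_nonsing_inv _ hd, Matrix.mul_one, add_smul]
        congr 1
        abel
      rw [adiBlock, Matrix.mul_smul, hmul, hstep, smul_smul, ← Complex.ofReal_mul, hquot]
  exact fun i => key i i.isLt

theorem colSpan_eq_range_mulVecLin {κ : Type*} [Fintype κ] (M : Matrix (Fin n) κ ℂ) :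
    colSpan M = LinearMap.range M.mulVecLin :=
  (range_mulVecLin M).symm

theorem colSpan_le_colSpan_iff {κ l : Type*} [Fintype κ] {M : Matrix (Fin n) l ℂ}
    {N : Matrix (Fin n) κ ℂ} : colSpan M ≤ colSpan N ↔ ∃ Y : Matrix κ l ℂ, N * Y = M := by
  rw [colSpan, Submodule.span_le, colSpan_eq_range_mulVecLin]
  constructor
  · intro h
    choose y hy using fun j => h (Set.mem_range_self j)
    exact ⟨Matrix.of fun i j => y j i, by
      ext i j; exact congrFun (hy j) i⟩
  · rintro ⟨Y, rfl⟩ _ ⟨j, rfl⟩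
    exact ⟨Y.col j, by ext i; rfl⟩

/-- The ADI factor and the basis matrix of the Krylov subspace differ by an invertible factor. -/
theorem exists_basis_mul_eq_adiFactor (hE : IsUnit E.det) (hpos : ∀ i, 0 < (σ i).re)
    (hu : ∀ i, IsUnit (toC (E⁻¹ * A) - σ i • 1))
    (hdim : Module.finrank ℂ (krylovSubspace A E B σ) = k * m)
    {V : Matrix (Fin n) (Fin (k * m)) ℝ} (hV : IsRealBasis V (krylovSubspace A E B σ)) :
    ∃ (Y : Matrix (Fin (k * m)) (Fin k × Fin m) ℂ) (Y' : Matrix (Fin k × Fin m) (Fin (k * m)) ℂ),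
      toC V * Y = adiFactor A E B σ ∧ Y * Y' = 1 ∧ Y' * Y = 1 := by
  have hadi := isADISequence_adiBlock (B := B) hE hpos hu
  have hle : krylovSubspace A E B σ ≤ colSpan (adiFactor A E B σ) := by
    refine iSup_le fun i => colSpan_le_colSpan_iff.2 ?_
    obtain ⟨N, hN⟩ := hadi.exists_blockRow_mul_eq hpos
      (fun i => Real.sq_sqrt (mul_pos two_pos (hpos i)).le) i (hu i)
    exact ⟨N, by rw [inv_toC_sub_smul_mul hE, ← toC_mul]; exact hN⟩
  have hfr : Module.finrank ℂ (colSpan (adiFactor A E B σ)) ≤ k * m := by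
    rw [colSpan_eq_range_mulVecLin]
    simpa [Matrix.rank] using (adiFactor A E B σ).rank_le_card_width
  have heq := Submodule.eq_of_le_of_finrank_le hle (hfr.trans hdim.ge)
  obtain ⟨Y, hY⟩ := colSpan_le_colSpan_iff.1 (heq.symm.trans hV.2.symm).le
  have hLI : LinearIndependent ℂ (adiFactor A E B σ).col := by
    refine linearIndependent_iff_card_le_finrank_span.2 ?_
    have : Module.finrank ℂ (colSpan (adiFactor A E B σ)) = k * m := by rw [← heq, hdim]
    rw [Fintype.card_prod, Fintype.card_fin, Fintype.card_fin]
    exact this.ge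
  obtain ⟨N, hN⟩ := exists_mul_eq_one_of_linearIndependent_col hLI
  have h1 : N * toC V * Y = 1 := by rw [Matrix.mul_assoc, hY, hN]
  exact ⟨Y, N * toC V, hY, (mul_eq_one_comm_of_card_eq _ _ _ (by simp)).1 h1, h1⟩

end Setup

/-! ### The projected system -/

section Realization
open scoped Kronecker

variable {n m k q : ℕ} {A E : Matrix (Fin n) (Fin n) ℝ} {B : Matrix (Fin n) (Fin m) ℝ}
  {σ : Fin k → ℂ}

theorem sq_sqrt_two_mul_re (hpos : ∀ i, 0 < (σ i).re) (i : Fin k) :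
    Real.sqrt (2 * (σ i).re) ^ 2 = 2 * (σ i).re :=
  Real.sq_sqrt (mul_pos two_pos (hpos i)).le

/-- The Sylvester equation of the ADI factor in the coordinates `Y`: multiply it from the left by
`X E`, where `X E V = I`. -/
theorem projected_sylvester (hE : IsUnit E.det) (hpos : ∀ i, 0 < (σ i).re)
    (hu : ∀ i, IsUnit (toC (E⁻¹ * A) - σ i • 1))
    {V : Matrix (Fin n) (Fin q) ℝ} {X : Matrix (Fin q) (Fin n) ℝ}
    {Y : Matrix (Fin q) (Fin k × Fin m) ℂ} (hY : toC V * Y = adiFactor A E B σ)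
    (hX : X * E * V = 1) :
    toC (X * A * V) * Y
      = Y * (adiCoupling σ (fun i => Real.sqrt (2 * (σ i).re)) ⊗ₖ (1 : Matrix (Fin m) (Fin m) ℂ))
        + toC (X * B) * adiWeights (Fin m) (fun i => Real.sqrt (2 * (σ i).re)) := by
  have h : toC (E⁻¹ * A) * adiFactor A E B σ = adiFactor A E B σ *
      (adiCoupling σ (fun i => Real.sqrt (2 * (σ i).re)) ⊗ₖ (1 : Matrix (Fin m) (Fin m) ℂ))
        + toC (E⁻¹ * B) * adiWeights (Fin m) (fun i => Real.sqrt (2 * (σ i).re)) :=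
    (isADISequence_adiBlock (B := B) hE hpos hu).mul_blockRow
  have hA : toC (X * A * V) * Y = toC (X * E) * (toC (E⁻¹ * A) * adiFactor A E B σ) := by
    rw [← hY, ← Matrix.mul_assoc, ← Matrix.mul_assoc, ← toC_mul, ← toC_mul, Matrix.mul_assoc X E,
      mul_nonsing_inv_cancel_left _ _ hE]
  rw [hA, h, Matrix.mul_add, ← hY, ← Matrix.mul_assoc, ← Matrix.mul_assoc, ← Matrix.mul_assoc,
    ← toC_mul, ← toC_mul, hX, toC_one, Matrix.one_mul, Matrix.mul_assoc X E,
    mul_nonsing_inv_cancel_left _ _ hE]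

theorem toC_lyapunov {a : Matrix (Fin q) (Fin q) ℝ} {b : Matrix (Fin q) (Fin m) ℝ}
    {P : Matrix (Fin q) (Fin q) ℝ} (h : SolvesLyapunov a 1 b P) :
    toC a * toC P + toC P * (toC a)ᴴ + toC b * (toC b)ᴴ = 0 := by
  have := congrArg toC h
  simpa [toC_add, toC_mul, toC_transpose, toC_zero] using this

theorem solvesLyapunov_of_toC {a : Matrix (Fin q) (Fin q) ℝ} {b : Matrix (Fin q) (Fin m) ℝ}
    {P : Matrix (Fin q) (Fin q) ℝ}
    (h : toC a * toC P + toC P * (toC a)ᴴ + toC b * (toC b)ᴴ = 0) : SolvesLyapunov a 1 b P := by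
  refine toC_injective ?_
  simpa [toC_add, toC_mul, toC_transpose, toC_zero] using h

/-- Multiplication by `e⁻¹` from the left and `e⁻ᵀ` from the right. -/
theorem SolvesLyapunov.normalize {a e P : Matrix (Fin q) (Fin q) ℝ} {b : Matrix (Fin q) (Fin m) ℝ}
    (he : IsUnit e.det) (h : SolvesLyapunov a e b P) : SolvesLyapunov (e⁻¹ * a) 1 (e⁻¹ * b) P := by
  have het : IsUnit eᵀ.det := by rwa [det_transpose]
  have h1 := congrArg (fun M => e⁻¹ * M * (e⁻¹)ᵀ) h
  simp only [Matrix.mul_zero, Matrix.zero_mul] at h1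
  refine Eq.trans ?_ h1
  simp only [Matrix.mul_add, Matrix.add_mul, transpose_mul, transpose_one, Matrix.mul_one,
    Matrix.one_mul, Matrix.mul_assoc, transpose_nonsing_inv, mul_nonsing_inv _ het,
    nonsing_inv_mul_cancel_left _ _ he]

theorem eq_mul_conjTranspose_of_basis {V : Matrix (Fin n) (Fin q) ℝ}
    (hV : LinearIndependent ℂ (toC V).col) {κ : Type*} [Fintype κ]
    {Y : Matrix (Fin q) κ ℂ} {P : Matrix (Fin q) (Fin q) ℝ}
    (h : toC (V * P * Vᵀ) = toC V * Y * (toC V * Y)ᴴ) : toC P = Y * Yᴴ := by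
  obtain ⟨N, hN⟩ := exists_mul_eq_one_of_linearIndependent_col hV
  have hN' : (toC V)ᴴ * Nᴴ = 1 := by rw [← conjTranspose_mul, hN, conjTranspose_one]
  have h1 := congrArg (fun M => N * M * Nᴴ) h
  simp only [toC_mul, toC_transpose, conjTranspose_mul] at h1
  have e : ∀ M : Matrix (Fin q) (Fin q) ℂ, N * (toC V * M * (toC V)ᴴ) * Nᴴ = M := by
    intro M
    rw [← Matrix.mul_assoc, ← Matrix.mul_assoc, hN, Matrix.one_mul, Matrix.mul_assoc, hN',
      Matrix.mul_one]
  have h2 : toC V * Y * (Yᴴ * (toC V)ᴴ) = toC V * (Y * Yᴴ) * (toC V)ᴴ := by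
    simp only [Matrix.mul_assoc]
  rwa [e, h2, e] at h1

/-- The explicit form of a projected system reproducing the ADI approximation, in terms of the
coordinates `Y` of the ADI factor: `E_q⁻¹ B_q = -Y Lᴴ` and `E_q⁻¹ A_q Y = -Y Tᴴ`. -/
theorem ReproducesADI.explicit_form (hE : IsUnit E.det) (hpos : ∀ i, 0 < (σ i).re)
    (hu : ∀ i, IsUnit (toC (E⁻¹ * A) - σ i • 1))
    {V W : Matrix (Fin n) (Fin q) ℝ} {P : Matrix (Fin q) (Fin q) ℝ}
    (hV : LinearIndependent ℂ (toC V).col)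
    {Y : Matrix (Fin q) (Fin k × Fin m) ℂ} (hY : toC V * Y = adiFactor A E B σ)
    (h : ReproducesADI A E B σ V W P) :
    toC ((Wᵀ * E * V)⁻¹ * (Wᵀ * B))
        = -(Y * (adiWeights (Fin m) fun i => Real.sqrt (2 * (σ i).re))ᴴ) ∧
      toC ((Wᵀ * E * V)⁻¹ * (Wᵀ * A * V)) * Y
        = -(Y * (adiCoupling σ (fun i => Real.sqrt (2 * (σ i).re)) ⊗ₖ
            (1 : Matrix (Fin m) (Fin m) ℂ))ᴴ) := by
  obtain ⟨he, hl, hP⟩ := h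
  have hs := projected_sylvester (X := (Wᵀ * E * V)⁻¹ * Wᵀ) hE hpos hu hY (by
    simpa only [Matrix.mul_assoc] using nonsing_inv_mul _ he)
  have hP' := eq_mul_conjTranspose_of_basis hV (hY.symm ▸ hP)
  have hl' := toC_lyapunov (hl.normalize he)
  rw [hP'] at hl'
  have e1 : (Wᵀ * E * V)⁻¹ * Wᵀ * A * V = (Wᵀ * E * V)⁻¹ * (Wᵀ * A * V) := by
    simp only [Matrix.mul_assoc]
  rw [e1, Matrix.mul_assoc _ Wᵀ B] at hs
  have hL := adiWeights_conjTranspose_mul_self (μ := Fin m) (sq_sqrt_two_mul_re hpos)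
  have hb := eq_neg_of_lyapunov hL hs hl'
  exact ⟨hb, mul_eq_neg_mul_conjTranspose hL hs hb⟩

/-- The input matrix forced by the Lyapunov equation is real, because `V Y Lᴴ = Z Lᴴ` is the
difference of the final residual factor and `E⁻¹ B`. -/
theorem exists_toC_eq_neg_mul_adiWeights (hE : IsUnit E.det) (hpos : ∀ i, 0 < (σ i).re)
    (hu : ∀ i, IsUnit (toC (E⁻¹ * A) - σ i • 1))
    (hdist : Function.Injective σ) (hconj : ∀ i, ∃ j, σ j = conj (σ i))
    {V : Matrix (Fin n) (Fin q) ℝ} (hV : LinearIndependent ℂ (toC V).col)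
    {Y : Matrix (Fin q) (Fin k × Fin m) ℂ} (hY : toC V * Y = adiFactor A E B σ) :
    ∃ b : Matrix (Fin q) (Fin m) ℝ,
      toC b = -(Y * (adiWeights (Fin m) fun i => Real.sqrt (2 * (σ i).re))ᴴ) := by
  set L := adiWeights (Fin m) fun i => Real.sqrt (2 * (σ i).re)
  have hr := (isADISequence_adiBlock (B := B) hE hpos hu).map_conj_residual
    (sq_sqrt_two_mul_re hpos) hu hdist hconj (toC_map_conj _) (toC_map_conj _)
  have hZL : adiFactor A E B σ * Lᴴ
      = ∑ j, ((Real.sqrt (2 * (σ j).re) : ℝ) : ℂ) • adiBlock A E B σ j j.isLt := by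
    ext r a
    simp [mul_apply, adiFactor, L, adiWeights, Fintype.sum_prod_type, Matrix.sum_apply,
      apply_ite conj]
    exact Finset.sum_congr rfl fun _ _ => mul_comm _ _
  rw [Matrix.map_add _ (map_add _), toC_map_conj, ← hZL] at hr
  have hr := add_left_cancel hr
  obtain ⟨N, hN⟩ := exists_mul_eq_one_of_linearIndependent_col hV
  rw [← hY, Matrix.mul_assoc, Matrix.map_mul, toC_map_conj] at hr
  have h1 := congrArg (fun M => N * M) hr
  simp only [← Matrix.mul_assoc N, hN, Matrix.one_mul] at h1
  refine exists_toC_eq ?_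
  ext i j
  simpa using congrArg Neg.neg (congrFun (congrFun h1 i) j)

end Realization

theorem theorem3p2 {n m k : ℕ}
    (A E : Matrix (Fin n) (Fin n) ℝ) (B : Matrix (Fin n) (Fin m) ℝ)
    (hE : IsUnit E.det) (hstab : AsymptoticallyStable A E)
    (σ : Fin k → ℂ) (hpos : ∀ i, 0 < (σ i).re) (hdist : Function.Injective σ)
    (hconj : ∀ i, ∃ j, σ j = conj (σ i))
    (hdim : Module.finrank ℂ (krylovSubspace A E B σ) = k * m)
    (V : Matrix (Fin n) (Fin (k * m)) ℝ) (hV : IsRealBasis V (krylovSubspace A E B σ)) :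
    -- existence, when the column space of `[E V, B]` is `(q + m)`-dimensional
    ((Matrix.fromCols (E * V) B).rank = k * m + m →
      ∃ (W : Matrix (Fin n) (Fin (k * m)) ℝ) (P : Matrix (Fin (k * m)) (Fin (k * m)) ℝ),
        ReproducesADI A E B σ V W P ∧
        ∀ P' : Matrix (Fin (k * m)) (Fin (k * m)) ℝ,
          SolvesLyapunov (Wᵀ * A * V) (Wᵀ * E * V) (Wᵀ * B) P' → P' = P) ∧
    -- uniqueness of the explicit form of the reduced system
    (∀ (W₁ W₂ : Matrix (Fin n) (Fin (k * m)) ℝ)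
        (P₁ P₂ : Matrix (Fin (k * m)) (Fin (k * m)) ℝ),
      ReproducesADI A E B σ V W₁ P₁ → ReproducesADI A E B σ V W₂ P₂ →
        (W₁ᵀ * E * V)⁻¹ * (W₁ᵀ * A * V) = (W₂ᵀ * E * V)⁻¹ * (W₂ᵀ * A * V) ∧
        (W₁ᵀ * E * V)⁻¹ * (W₁ᵀ * B) = (W₂ᵀ * E * V)⁻¹ * (W₂ᵀ * B)) := by
  have hu : ∀ i, IsUnit (toC (E⁻¹ * A) - σ i • 1) := fun i =>
    isUnit_sub_smul_one_of_asymptoticallyStable hstab (hpos i)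
  obtain ⟨Y, Y', hY, hYY', hY'Y⟩ := exists_basis_mul_eq_adiFactor hE hpos hu hdim hV
  constructor
  · intro hrank
    have hLI : LinearIndependent ℝ (Matrix.fromCols (E * V) B).col := by
      refine linearIndependent_iff_card_le_finrank_span.2 ?_
      rw [rank_eq_finrank_span_cols] at hrank
      rw [Fintype.card_sum, Fintype.card_fin, Fintype.card_fin]
      exact hrank.ge
    obtain ⟨N, hN⟩ := exists_mul_eq_one_of_linearIndependent_col hLI
    obtain ⟨b, hb⟩ := exists_toC_eq_neg_mul_adiWeights hE hpos hu hdist hconj hV.1 hY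
    -- `X = Wᵀ` solves `X [E V, B] = [I, b]`
    obtain ⟨X, hXE, hXB⟩ : ∃ X : Matrix (Fin (k * m)) (Fin n) ℝ, X * E * V = 1 ∧ X * B = b := by
      let R : Matrix (Fin (k * m)) (Fin (k * m) ⊕ Fin m) ℝ :=
        Matrix.fromCols (1 : Matrix (Fin (k * m)) (Fin (k * m)) ℝ) b
      have h : R * N * Matrix.fromCols (E * V) B = R := by
        rw [Matrix.mul_assoc, hN, Matrix.mul_one]
      rw [mul_fromCols, fromCols_ext_iff] at h
      exact ⟨R * N, by rw [Matrix.mul_assoc]; exact h.1, h.2⟩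
    have hs := projected_sylvester hE hpos hu hY hXE
    have hL := adiWeights_conjTranspose_mul_self (μ := Fin m) (sq_sqrt_two_mul_re hpos)
    rw [hXB] at hs
    have ha := mul_eq_neg_mul_conjTranspose hL hs hb
    have hlyap : toC (X * A * V) * (Y * Yᴴ) + Y * Yᴴ * (toC (X * A * V))ᴴ + toC b * (toC b)ᴴ
        = 0 := by
      rw [lyapunov_defect_eq hL hs, hb]; simp
    have huniq := fun D D' => eq_of_lyapunov_of_mul_eq (D := D) (D' := D')
      (Q := toC b * (toC b)ᴴ) (re_pos_of_det_kronecker_eq_zero hpos) hYY' hY'Y ha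
    -- `Y Yᴴ` and its conjugate solve the same real equation, so `Y Yᴴ` is real
    obtain ⟨P, hP⟩ : ∃ P, toC P = Y * Yᴴ := by
      refine exists_toC_eq (huniq _ _ ?_ hlyap)
      have := congrArg (fun M : Matrix _ _ ℂ => M.map (starRingEnd ℂ)) hlyap
      simpa only [Matrix.map_add _ (map_add _), Matrix.map_mul, ← toC_transpose, toC_map_conj,
        Matrix.map_zero _ (map_zero (starRingEnd ℂ))] using this
    have hPsol : SolvesLyapunov (X * A * V) 1 b P := solvesLyapunov_of_toC (by rwa [hP])
    refine ⟨Xᵀ, P, ⟨?_, ?_, ?_⟩, ?_⟩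
    · rw [transpose_transpose, hXE]; simp
    · rwa [transpose_transpose, hXE, hXB]
    · rw [toC_mul, toC_mul, hP, toC_transpose, ← hY, conjTranspose_mul]
      simp only [Matrix.mul_assoc]
    · intro P' hP'
      rw [transpose_transpose, hXE, hXB] at hP'
      exact toC_injective (huniq _ _ (toC_lyapunov hP') (toC_lyapunov hPsol))
  · intro W₁ W₂ P₁ P₂ h₁ h₂
    obtain ⟨hb₁, ha₁⟩ := h₁.explicit_form hE hpos hu hV.1 hY
    obtain ⟨hb₂, ha₂⟩ := h₂.explicit_form hE hpos hu hV.1 hY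
    refine ⟨toC_injective ?_, toC_injective (hb₁.trans hb₂.symm)⟩
    have h := congrArg (fun M => M * Y') (ha₁.trans ha₂.symm)
    simpa only [Matrix.mul_assoc _ Y Y', hYY', Matrix.mul_one] using h
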